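/- Let $G_4$ be the cubic graph with 6 vertices and 9 edges formed by the six sides and the three long diagonals of a regular hexagon, and let the dihedral group $D_6$ of order 12 act on $G_4$ by the symmetries of the hexagon. A magic distinct labelling of $G_4$ with magic sum $s$ is an assignment of pairwise distinct nonnegative integers to the edges such that, for each vertex, the labels of the edges incident to it sum to $s$. Two such labellings are isomorphic under $D_6$ if an element of $D_6$ carries one to the other. Then for every integer $s\ge 0$ the number $\widetilde h(s)$ of magic distinct labellings of $G_4$ with magic sum $s$, up to isomorphism under $D_6$, is finite and divisible by $6$. -/

import Mathlib

namespace MagicLabelling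

section General

variable {V : Type*}

/-- The weight of the vertex `v` under the edge labelling `μ`: the sum of the labels of all
edges `vw` incident to `v`. -/
def weight (G : SimpleGraph V) [G.LocallyFinite] (μ : G.edgeSet → ℕ) (v : V) : ℕ :=
  ∑ w : G.neighborSet v, μ ⟨s(v, (w : V)), w.2⟩

/-- `μ` is a magic labelling of `G` with magic sum `s`: every vertex has weight `s`. -/
def IsMagic (G : SimpleGraph V) [G.LocallyFinite] (s : ℕ) (μ : G.edgeSet → ℕ) : Prop :=
  ∀ v, weight G μ v = s

/-- Magic distinct labellings of `G` with magic sum `s`: magic labellings by nonnegative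
integers in which different edges carry different labels. -/
def MagicDistinct (G : SimpleGraph V) [G.LocallyFinite] (s : ℕ) : Type _ :=
  {μ : G.edgeSet → ℕ // IsMagic G s μ ∧ Function.Injective μ}

end General

/-- The cubic graph with 6 vertices and 9 edges formed by the sides and the three long diagonals
of a regular hexagon, whose corners are numbered cyclically by `ZMod 6`. -/
def G4 : SimpleGraph (ZMod 6) where
  Adj i j := j = i + 1 ∨ i = j + 1 ∨ j = i + 3
  symm := ⟨by decide⟩
  loopless := ⟨by decide⟩

instance : DecidableRel G4.Adj := fun i j =>
  inferInstanceAs (Decidable (j = i + 1 ∨ i = j + 1 ∨ j = i + 3))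

/-- The symmetries of the hexagon acting on its corners: rotations `r k : i ↦ i + k` and
reflections `sr k : i ↦ -(i + k)`. -/
def hexagonMap : DihedralGroup 6 → ZMod 6 → ZMod 6
  | .r k, i => i + k
  | .sr k, i => -(i + k)

theorem hexagonMap_one (i : ZMod 6) : hexagonMap 1 i = i := by
  rw [DihedralGroup.one_def]; simp [hexagonMap]

theorem hexagonMap_mul (g h : DihedralGroup 6) (i : ZMod 6) :
    hexagonMap (g * h) i = hexagonMap g (hexagonMap h i) := by
  rcases g with a | a <;> rcases h with b | b <;> simp [hexagonMap] <;> ring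

theorem hexagonMap_adj (g : DihedralGroup 6) (i j : ZMod 6) :
    G4.Adj (hexagonMap g i) (hexagonMap g j) ↔ G4.Adj i j := by
  rcases g with a | a <;> revert a i j <;> decide

/-- The dihedral group of order 12 as a group of automorphisms of `G4`. -/
def dihedralAut : DihedralGroup 6 →* (G4 ≃g G4) where
  toFun g :=
    { toFun := hexagonMap g
      invFun := hexagonMap g⁻¹
      left_inv := fun i => by rw [← hexagonMap_mul, inv_mul_cancel, hexagonMap_one]
      right_inv := fun i => by rw [← hexagonMap_mul, mul_inv_cancel, hexagonMap_one]
      map_rel_iff' := hexagonMap_adj g _ _ }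
  map_one' := by ext i; exact hexagonMap_one i
  map_mul' g h := by ext i; exact hexagonMap_mul g h i

/-- Two magic distinct labellings of `G4` are isomorphic under the dihedral group when a symmetry
of the hexagon carries one to the other. -/
def dihedralSetoid (s : ℕ) : Setoid (MagicDistinct G4 s) where
  r μ ν := ∃ g : DihedralGroup 6, ∀ e : G4.edgeSet, ν.1 ((dihedralAut g).mapEdgeSet e) = μ.1 e
  iseqv :=
    { refl := fun μ => ⟨1, fun e => by
        refine congrArg μ.1 (Subtype.ext ?_); rw [map_one]
        exact congrFun Sym2.map_id e.1⟩
      symm := by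
        rintro μ ν ⟨g, h⟩
        refine ⟨g⁻¹, fun e => ?_⟩
        rw [← h]; refine congrArg ν.1 (Subtype.ext ?_)
        change Sym2.map (dihedralAut g) (Sym2.map (dihedralAut g⁻¹) e.1) = e.1
        rw [Sym2.map_map, ← RelIso.coe_mul, ← map_mul, mul_inv_cancel, map_one]
        exact congrFun Sym2.map_id e.1
      trans := by
        rintro μ ν ρ ⟨g, h⟩ ⟨k, h'⟩
        refine ⟨k * g, fun e => ?_⟩
        rw [← h, ← h']; refine congrArg ρ.1 (Subtype.ext ?_)
        change Sym2.map (dihedralAut (k * g)) e.1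
          = Sym2.map (dihedralAut k) (Sym2.map (dihedralAut g) e.1)
        rw [Sym2.map_map, map_mul, RelIso.coe_mul] }

/-- Isomorphism classes, under the dihedral group of order 12, of magic distinct labellings of
`G4` with magic sum `s`. -/
def Classes (s : ℕ) : Type := Quotient (dihedralSetoid s)

/-- The number of magic distinct labellings of `G4` with magic sum `s`, up to isomorphism under
the dihedral group of order 12. -/
noncomputable def hTilde (s : ℕ) : ℕ := Nat.card (Classes s)

end MagicLabelling

/-!
The corners of even and of odd number are the two sides of `G4`, so `G4` is the complete bipartite
graph `K₃,₃`, and its automorphism group contains, besides the dihedral group of order 12, the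
wreath product `S₃ ≀ C₂` of order 72 (`wreathAut`). An automorphism that carries a labelling with
pairwise distinct labels to itself fixes every edge, and an automorphism of `G4` fixing every edge
is the identity. Hence every group that embeds into the automorphism group acts freely on the
magic distinct labellings, and its order times the number of its orbits is the number of
labellings (`card_magicDistinct_eq`). Counting the orbits of both groups gives
`12 * hTilde s = 72 * m`, where `m` is the number of orbits of the wreath product, so
`hTilde s = 6 * m`. The counts are finite because no label exceeds `s`.
-/

namespace MagicLabelling

/-! ### The action of automorphisms on magic distinct labellings -/

section Action

variable {V : Type*} {G : SimpleGraph V} {s : ℕ}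

theorem mapEdgeSet_one (e : G.edgeSet) : (1 : G ≃g G).mapEdgeSet e = e :=
  Subtype.ext (congrFun Sym2.map_id e.1)

theorem mapEdgeSet_mul (f g : G ≃g G) (e : G.edgeSet) :
    (f * g).mapEdgeSet e = f.mapEdgeSet (g.mapEdgeSet e) := by
  refine Subtype.ext ?_
  change Sym2.map (f * g) e.1 = Sym2.map f (Sym2.map g e.1)
  rw [Sym2.map_map, RelIso.coe_mul]

variable [G.LocallyFinite]

theorem weight_comp_mapEdgeSet (μ : G.edgeSet → ℕ) (f : G ≃g G) (v : V) :
    weight G (fun e => μ (f.mapEdgeSet e)) v = weight G μ (f v) :=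
  Fintype.sum_equiv (f.mapNeighborSet v) _ _ fun _ => rfl

/-- Automorphisms act on labellings by transport: `f • μ` gives the edge `e` the label that `μ`
gives to `f⁻¹ e`. -/
instance : MulAction (G ≃g G) (MagicDistinct G s) where
  smul f μ := ⟨fun e => μ.1 (f⁻¹.mapEdgeSet e),
    fun v => (weight_comp_mapEdgeSet μ.1 f⁻¹ v).trans (μ.2.1 _),
    μ.2.2.comp f⁻¹.mapEdgeSet.injective⟩
  one_smul μ := Subtype.ext <| funext fun e => by
    change μ.1 ((1 : G ≃g G)⁻¹.mapEdgeSet e) = μ.1 e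
    rw [inv_one, mapEdgeSet_one]
  mul_smul f g μ := Subtype.ext <| funext fun e => by
    change μ.1 ((f * g)⁻¹.mapEdgeSet e) = μ.1 (g⁻¹.mapEdgeSet (f⁻¹.mapEdgeSet e))
    rw [mul_inv_rev, mapEdgeSet_mul]

theorem smul_apply_mapEdgeSet (f : G ≃g G) (μ : MagicDistinct G s) (e : G.edgeSet) :
    (f • μ).1 (f.mapEdgeSet e) = μ.1 e := by
  change μ.1 (f⁻¹.mapEdgeSet (f.mapEdgeSet e)) = μ.1 e
  rw [← mapEdgeSet_mul, inv_mul_cancel, mapEdgeSet_one]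

theorem eq_smul_iff (f : G ≃g G) (μ ν : MagicDistinct G s) :
    ν = f • μ ↔ ∀ e, ν.1 (f.mapEdgeSet e) = μ.1 e := by
  refine ⟨?_, fun h => Subtype.ext <| funext fun e => ?_⟩
  · rintro rfl
    exact smul_apply_mapEdgeSet f μ
  · obtain ⟨e, rfl⟩ := f.mapEdgeSet.surjective e
    rw [h, smul_apply_mapEdgeSet]

theorem mapEdgeSet_eq_self_of_smul_eq {f : G ≃g G} {μ : MagicDistinct G s} (h : f • μ = μ)
    (e : G.edgeSet) : f.mapEdgeSet e = e :=
  μ.2.2 ((eq_smul_iff f μ μ).1 h.symm e)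

theorem le_magicSum {μ : G.edgeSet → ℕ} (hμ : IsMagic G s μ) (e : G.edgeSet) : μ e ≤ s := by
  obtain ⟨e, he⟩ := e
  induction e with
  | _ v w =>
    rw [← hμ v]
    exact Finset.single_le_sum (f := fun w : G.neighborSet v => μ ⟨s(v, (w : V)), w.2⟩)
      (fun _ _ => Nat.zero_le _) (Finset.mem_univ (⟨w, he⟩ : G.neighborSet v))

instance [Finite V] : Finite (MagicDistinct G s) :=
  Finite.of_injective
    (fun (μ : MagicDistinct G s) (e : G.edgeSet) =>
      (⟨μ.1 e, Nat.lt_succ_of_le (le_magicSum μ.2.1 e)⟩ : Fin (s + 1)))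
    fun _ _ h => Subtype.ext <| funext fun e => congrArg Fin.val (congrFun h e)

end Action

/-! ### Free actions on the labellings of `G4` -/

/-- Each corner is the only common endpoint of two edges, so it is fixed when they are. -/
theorem eq_one_of_mapEdgeSet_eq_self {f : G4 ≃g G4} (h : ∀ e, f.mapEdgeSet e = e) : f = 1 := by
  have key : ∀ i j : ZMod 6, G4.Adj i j → s(f i, f j) = s(i, j) := fun i j hij =>
    congrArg Subtype.val (h ⟨s(i, j), hij⟩)
  ext i
  have h₁ := key i (i + 1) (Or.inl rfl)
  have h₃ := key i (i + 3) (Or.inr (Or.inr rfl))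
  have hne : i + 1 ≠ i + 3 := by
    rw [Ne, add_right_inj]
    decide
  simp only [Sym2.eq_iff] at h₁ h₃
  change f i = i
  rcases h₁ with h₁ | h₁
  · exact h₁.1
  · rcases h₃ with h₃ | h₃
    · exact h₃.1
    · exact absurd (h₁.1.symm.trans h₃.1) hne

/-- The labellings of `G4` up to the action of a group `Γ` through a homomorphism to the
automorphism group. -/
abbrev Orbits {Γ : Type*} [Group Γ] (φ : Γ →* (G4 ≃g G4)) (s : ℕ) : Type :=
  letI := MulAction.compHom (MagicDistinct G4 s) φ
  MulAction.orbitRel.Quotient Γ (MagicDistinct G4 s)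

theorem card_magicDistinct_eq {Γ : Type*} [Group Γ] (φ : Γ →* (G4 ≃g G4))
    (hφ : Function.Injective φ) (s : ℕ) :
    Nat.card (MagicDistinct G4 s) = Nat.card (Orbits φ s) * Nat.card Γ := by
  let := MulAction.compHom (MagicDistinct G4 s) φ
  rw [← Nat.card_prod]
  refine Nat.card_congr (MulAction.selfEquivOrbitsQuotientProd fun μ => ?_)
  refine (Subgroup.eq_bot_iff_forall _).2 fun g hg => hφ ?_
  have hg' : φ g • μ = μ := hg
  rw [map_one]
  exact eq_one_of_mapEdgeSet_eq_self (mapEdgeSet_eq_self_of_smul_eq hg')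

/-! ### The dihedral group -/

theorem dihedralAut_injective : Function.Injective dihedralAut := by
  have key : ∀ g h : DihedralGroup 6, (∀ i, hexagonMap g i = hexagonMap h i) → g = h := by
    rintro (a | a) (b | b) <;> simp only [DihedralGroup.r.injEq, DihedralGroup.sr.injEq,
      reduceCtorEq] <;> revert a b <;> decide
  exact fun g h hgh => key g h fun i => DFunLike.congr_fun hgh i

theorem card_orbits_dihedralAut (s : ℕ) : Nat.card (Orbits dihedralAut s) = hTilde s := by
  let := MulAction.compHom (MagicDistinct G4 s) dihedralAut
  refine Nat.card_congr (Quotient.congr (Equiv.refl _) fun μ ν => ?_)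
  -- The orbit relation asks for an element moving `ν` to `μ`, `dihedralSetoid` for one moving
  -- `μ` to `ν`.
  refine Iff.trans ?_ (Setoid.comm' (dihedralSetoid s))
  change (∃ g, dihedralAut g • ν = μ) ↔ ∃ g, ∀ e, μ.1 ((dihedralAut g).mapEdgeSet e) = ν.1 e
  exact exists_congr fun g => eq_comm.trans (eq_smul_iff _ _ _)

/-! ### The wreath product of order 72 -/

/-- The corners of the hexagon as pairs of a residue modulo 3 and a parity. -/
def cornerEquiv : ZMod 6 ≃ ZMod 3 × Multiplicative (ZMod 2) :=
  (ZMod.chineseRemainder (show Nat.Coprime 3 2 by decide)).toEquiv.trans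
    (Equiv.prodCongr (Equiv.refl _) Multiplicative.ofAdd)

/-- `G4` is complete bipartite, its sides being the two parity classes. -/
theorem adj_iff_parity_ne (i j : ZMod 6) :
    G4.Adj i j ↔ (cornerEquiv i).2 ≠ (cornerEquiv j).2 := by
  revert i j
  decide

/-- The wreath product `S₃ ≀ C₂`, which permutes the corners within the two parity classes
independently and interchanges the classes, as a group of automorphisms of `G4`. -/
def wreathAut :
    RegularWreathProduct (Equiv.Perm (ZMod 3)) (Multiplicative (ZMod 2)) →* (G4 ≃g G4) where
  toFun w :=
    { toEquiv := cornerEquiv.symm.permCongr (RegularWreathProduct.toPerm _ _ (ZMod 3) w)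
      map_rel_iff' := by
        intro i j
        simp [adj_iff_parity_ne, RegularWreathProduct.toPerm, Equiv.permCongr_apply] }
  map_one' := by
    ext i
    simp [Equiv.permCongr_apply]
  map_mul' w w' := by
    ext i
    simp [Equiv.permCongr_apply]

theorem wreathAut_injective : Function.Injective wreathAut := fun _ _ h =>
  RegularWreathProduct.toPermInj _ _ (ZMod 3) <| cornerEquiv.symm.permCongr.injective <|
    Equiv.ext fun i => DFunLike.congr_fun h i

theorem card_wreath :
    Nat.card (RegularWreathProduct (Equiv.Perm (ZMod 3)) (Multiplicative (ZMod 2))) = 72 := by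
  rw [RegularWreathProduct.card, Nat.card_perm, Nat.card_zmod,
    Nat.card_congr (Multiplicative.toAdd (α := ZMod 2)), Nat.card_zmod]
  rfl

end MagicLabelling

/-- The first conjunct records that `hTilde s` is a genuine count, not the default value of
`Nat.card` on an infinite type. -/
theorem mainTheorem7 (s : ℕ) :
    Finite (MagicLabelling.Classes s) ∧ 6 ∣ MagicLabelling.hTilde s := by
  open MagicLabelling in
  refine ⟨inferInstanceAs (Finite (Quotient (dihedralSetoid s))), ?_⟩
  have h₁ := card_magicDistinct_eq dihedralAut dihedralAut_injective s
  have h₂ := card_magicDistinct_eq wreathAut wreathAut_injective s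
  rw [card_orbits_dihedralAut, DihedralGroup.nat_card] at h₁
  rw [card_wreath] at h₂
  omega
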